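/- **Setting.** *Second-order arithmetic.* Formulas are built from $t=u$ and $t\in X$ (where $t,u$ are terms built from number variables with $+$ and $\times$, and $X$ is a set variable) with $\neg,\wedge,\vee$ and quantifiers over number variables and set variables; they are interpreted in the standard model $\mathbb N$, set quantifiers ranging over all subsets of $\mathbb N$. The free variables are the constant numbers $c_1,\dots,c_n$ and constant sets $S_1,\dots,S_m$ of the vocabulary. $\Sigma^1_0=\Pi^1_0$ is the class of formulas without set quantifiers; $\Sigma^1_{i+1}$ is the class of formulas $\exists\overline X\,\psi$ with $\overline X$ a tuple of set variables and $\psi\in\Pi^1_i$; $\Pi^1_{i+1}$ is the class of negations of $\Sigma^1_{i+1}$ formulas. $\Delta^1_i$ is the class of formulas equivalent in $\mathbb N$ both to a $\Sigma^1_i$ and to a $\Pi^1_i$ formula, and the analytical hierarchy is $\mathrm{AnH}=\bigcup_i\Delta^1_i$. *Variable-order logic.* Let $A$ be a non-empty universe and $a\ge 1$. A relation of arity $a$ and order $1$ is an element of $A$; a relation of arity $a$ and order $r+1$ is a set of $a$-tuples of relations of arity $a$ and order $r$. A sequence of relations of arity $a$ is a family $\mathcal X=(\mathcal X^r)_{r\ge1}$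 with $\mathcal X^r$ of arity $a$ and order $r$. Formulas of $\mathrm{VO}$ have order variables, ranging over positive integers, and, for each $a\ge1$, variables ranging over sequences of relations of arity $a$. The atomic formulas are $r=p$, $r<p$, $\mathcal X=_r\mathcal Y$ (meaning $\mathcal X^r=\mathcal Y^r$) and $\mathcal X^r(\mathcal Y_1,\dots,\mathcal Y_a)$ (meaning $r>1$ and $(\mathcal Y_1^{r-1},\dots,\mathcal Y_a^{r-1})\in\mathcal X^r$), where all relation variables of an atom have the same arity $a$. Formulas are closed under $\neg,\wedge,\vee$ and under universal and existential quantification over both kinds of variables. A structure consists of $A$ and an interpretation of the free variables. *Coding.* A pair of orders $(r,r')$ codes $0$ if it is $(1,1)$, and codes $n\ge1$ if it is $(n,2)$. A monadic sequence $\mathcal P$ codes the number $|\{y\in A: \mathcal P^2(y)\}|$ by cardinality. A monadic sequence $\mathcal X$ codes $S\subseteq\mathbb N$ if for every $n\in\mathbb N$ the relation $\mathcal X^{n+2}$ is the full relation when $n\in S$ and the empty relation when $n\notin S$. **Theorem** ($\mathrm{AnH}\subseteq\mathrm{VO}$). Let $\varphi(c_1,\dots,c_n,S_1,\dots,S_m)$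 be a formula of the analytical hierarchy. 1. There is a formula $\psi$ of $\mathrm{VO}$ whose free variables are among order variables $r_1,r_1',\dots,r_n,r_n'$ and monadic sequence variables $\mathcal X_1,\dots,\mathcal X_m$, such that for every non-empty finite universe $A$, all numbers $c_i$ and sets $S_j$, and every structure over $A$ in which $(r_i,r_i')$ codes $c_i$ for all $i$ and $\mathcal X_j$ codes $S_j$ for all $j$, the structure satisfies $\psi$ if and only if $\mathbb N\models\varphi(c_1,\dots,c_n,S_1,\dots,S_m)$. 2. There is a formula $\psi$ of $\mathrm{VO}$ without free order variables, whose free variables are among monadic sequence variables $\mathcal P_1,\dots,\mathcal P_n,\mathcal X_1,\dots,\mathcal X_m$, such that for every non-empty finite universe $A$, all numbers $c_i$ and sets $S_j$, and every structure over $A$ in which $\mathcal P_i$ codes $c_i$ by cardinality for all $i$ and $\mathcal X_j$ codes $S_j$ for all $j$, the structure satisfies $\psi$ if and only if $\mathbb N\models\varphi(c_1,\dots,c_n,S_1,\dots,S_m)$. -/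

import Mathlib

/-! ## Second-order arithmetic and the analytical hierarchy -/

/-- Arithmetical terms, built from number variables (named by natural numbers) with `+` and `×`. -/
inductive ArTerm : Type
  | var (x : ℕ) : ArTerm
  | add (t u : ArTerm) : ArTerm
  | mul (t u : ArTerm) : ArTerm

namespace ArTerm

/-- The value of a term in the standard model, `e` being the assignment of the variables. -/
def val (e : ℕ → ℕ) : ArTerm → ℕ
  | var x => e x
  | add t u => t.val e + u.val e
  | mul t u => t.val e * u.val e

/-- The variables of a term. -/
def vars : ArTerm → Set ℕ
  | var x => {x}
  | add t u => t.vars ∪ u.vars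
  | mul t u => t.vars ∪ u.vars

end ArTerm

/-- Formulas of second-order arithmetic, with number variables and set variables, both named by
natural numbers. The free variables play the role of the constant numbers and constant sets of the
vocabulary. -/
inductive ArFormula : Type
  | eq (t u : ArTerm) : ArFormula
  | mem (t : ArTerm) (X : ℕ) : ArFormula
  | neg (φ : ArFormula) : ArFormula
  | and (φ ψ : ArFormula) : ArFormula
  | or (φ ψ : ArFormula) : ArFormula
  | allNum (x : ℕ) (φ : ArFormula) : ArFormula
  | exNum (x : ℕ) (φ : ArFormula) : ArFormula
  | allSet (X : ℕ) (φ : ArFormula) : ArFormula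
  | exSet (X : ℕ) (φ : ArFormula) : ArFormula

namespace ArFormula

/-- Truth in the standard model `ℕ`; number variables are assigned by `e`, set variables by `s`,
and set quantifiers range over all subsets of `ℕ`. -/
def Holds : ArFormula → (ℕ → ℕ) → (ℕ → Set ℕ) → Prop
  | eq t u, e, _ => t.val e = u.val e
  | mem t X, e, s => t.val e ∈ s X
  | neg φ, e, s => ¬ φ.Holds e s
  | and φ ψ, e, s => φ.Holds e s ∧ ψ.Holds e s
  | or φ ψ, e, s => φ.Holds e s ∨ ψ.Holds e s
  | allNum x φ, e, s => ∀ n : ℕ, φ.Holds (Function.update e x n) s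
  | exNum x φ, e, s => ∃ n : ℕ, φ.Holds (Function.update e x n) s
  | allSet X φ, e, s => ∀ S : Set ℕ, φ.Holds e (Function.update s X S)
  | exSet X φ, e, s => ∃ S : Set ℕ, φ.Holds e (Function.update s X S)

/-- The free number variables. -/
def freeNum : ArFormula → Set ℕ
  | eq t u => t.vars ∪ u.vars
  | mem t _ => t.vars
  | neg φ => φ.freeNum
  | and φ ψ => φ.freeNum ∪ ψ.freeNum
  | or φ ψ => φ.freeNum ∪ ψ.freeNum
  | allNum x φ => φ.freeNum \ {x}
  | exNum x φ => φ.freeNum \ {x}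
  | allSet _ φ => φ.freeNum
  | exSet _ φ => φ.freeNum

/-- The free set variables. -/
def freeSet : ArFormula → Set ℕ
  | eq _ _ => ∅
  | mem _ X => {X}
  | neg φ => φ.freeSet
  | and φ ψ => φ.freeSet ∪ ψ.freeSet
  | or φ ψ => φ.freeSet ∪ ψ.freeSet
  | allNum _ φ => φ.freeSet
  | exNum _ φ => φ.freeSet
  | allSet X φ => φ.freeSet \ {X}
  | exSet X φ => φ.freeSet \ {X}

/-- Arithmetical formulas: all quantifiers are over numbers. -/
def IsArithmetical : ArFormula → Prop
  | eq _ _ => True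
  | mem _ _ => True
  | neg φ => φ.IsArithmetical
  | and φ ψ => φ.IsArithmetical ∧ ψ.IsArithmetical
  | or φ ψ => φ.IsArithmetical ∧ ψ.IsArithmetical
  | allNum _ φ => φ.IsArithmetical
  | exNum _ φ => φ.IsArithmetical
  | allSet _ _ => False
  | exSet _ _ => False

/-- `∃ X₁ … ∃ Xₖ, φ` for a tuple of set variables. -/
def exSets (L : List ℕ) (φ : ArFormula) : ArFormula :=
  L.foldr exSet φ

/-- The syntactic class `Π¹ᵢ`: for `i = 0` the arithmetical formulas, and otherwise the negations
of the `Σ¹ᵢ` formulas, that is, of the formulas `∃ X̄, ψ` with `ψ` in `Π¹ᵢ₋₁`. -/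
def IsPi : ℕ → ArFormula → Prop
  | 0, φ => φ.IsArithmetical
  | i + 1, φ => ∃ (L : List ℕ) (ψ : ArFormula), IsPi i ψ ∧ φ = neg (exSets L ψ)

/-- The syntactic class `Σ¹ᵢ`: for `i = 0` the arithmetical formulas, and otherwise the formulas
`∃ X̄, ψ` with `ψ` in `Π¹ᵢ₋₁`. -/
def IsSigma : ℕ → ArFormula → Prop
  | 0, φ => φ.IsArithmetical
  | i + 1, φ => ∃ (L : List ℕ) (ψ : ArFormula), IsPi i ψ ∧ φ = exSets L ψ

/-- Equivalence of formulas in the standard model. -/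
def Equivalent (φ ψ : ArFormula) : Prop :=
  ∀ (e : ℕ → ℕ) (s : ℕ → Set ℕ), φ.Holds e s ↔ ψ.Holds e s

/-- `Δ¹ᵢ`, the intersection of `Σ¹ᵢ` and `Π¹ᵢ` (as usual, up to equivalence of formulas). -/
def IsDelta (i : ℕ) (φ : ArFormula) : Prop :=
  (∃ ψ, IsSigma i ψ ∧ Equivalent φ ψ) ∧ (∃ ψ, IsPi i ψ ∧ Equivalent φ ψ)

/-- The analytical hierarchy, the union of the levels `Δ¹ᵢ`. -/
def Analytical (φ : ArFormula) : Prop :=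
  ∃ i : ℕ, IsDelta i φ

end ArFormula

/-! ## Variable-order logic -/

universe u

/-- `HRel A a k` is the type of relations of arity `a` and order `k + 1` over the universe `A`:
the relations of order `1` are the elements of `A`, and a relation of order `r + 1` is a set of
`a`-tuples of relations of order `r` (and arity `a`). -/
def HRel (A : Type u) (a : ℕ+) : ℕ → Type u
  | 0 => A
  | k + 1 => Set (Fin (a : ℕ) → HRel A a k)

/-- Sequences of relations of arity `a`: one relation of each order. The entry at `k` is the
element of order `k + 1`. -/
def RelSeq (A : Type u) (a : ℕ+) : Type u :=
  (k : ℕ) → HRel A a k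

/-- The element of order `r` of a sequence. -/
def RelSeq.at {A : Type u} {a : ℕ+} (X : RelSeq A a) (r : ℕ+) : HRel A a r.natPred :=
  X r.natPred

/-- `X^r(Y₁, …, Yₐ)`: `r > 1` and the tuple of the elements of order `r - 1` of the `Yᵢ` belongs to
the element of order `r` of `X`. (With `k = r - 1`, so that `k = 0` is the case `r = 1`.) -/
def RelSeq.AppIdx {A : Type u} {a : ℕ+} (X : RelSeq A a) (Y : Fin (a : ℕ) → RelSeq A a) :
    ℕ → Prop
  | 0 => False
  | k + 1 => Set.Mem (X (k + 1)) (fun i => Y i k)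

/-- Formulas of variable-order logic. Order variables are named by natural numbers; variables for
sequences of relations of arity `a` are named by the pair of `a` and a natural number. -/
inductive VOFormula : Type
  | app (a : ℕ+) (X r : ℕ) (Y : Fin (a : ℕ) → ℕ) : VOFormula
  | relEq (a : ℕ+) (r X Y : ℕ) : VOFormula
  | ordEq (r p : ℕ) : VOFormula
  | ordLt (r p : ℕ) : VOFormula
  | neg (φ : VOFormula) : VOFormula
  | and (φ ψ : VOFormula) : VOFormula
  | or (φ ψ : VOFormula) : VOFormula
  | allOrd (r : ℕ) (φ : VOFormula) : VOFormula
  | exOrd (r : ℕ) (φ : VOFormula) : VOFormula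
  | allRel (a : ℕ+) (X : ℕ) (φ : VOFormula) : VOFormula
  | exRel (a : ℕ+) (X : ℕ) (φ : VOFormula) : VOFormula

/-- A structure with universe `A` for variable-order logic: it interprets the order symbols by
positive integers and the `a`-ary relation symbols by sequences of relations of arity `a`. -/
structure VOStructure (A : Type u) where
  ord : ℕ → ℕ+
  rel : (a : ℕ+) → ℕ → RelSeq A a

namespace VOStructure

/-- The structure `𝔄[r/i]`. -/
def setOrd {A : Type u} (M : VOStructure A) (r : ℕ) (i : ℕ+) : VOStructure A where
  ord := Function.update M.ord r i
  rel := M.rel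

/-- The structure `𝔄[X/R]`. -/
def setRel {A : Type u} (M : VOStructure A) (a : ℕ+) (X : ℕ) (R : RelSeq A a) :
    VOStructure A where
  ord := M.ord
  rel := Function.update M.rel a (Function.update (M.rel a) X R)

end VOStructure

namespace VOFormula

/-- Satisfaction in variable-order logic. -/
def Sat {A : Type u} : VOFormula → VOStructure A → Prop
  | app a X r Y, M => (M.rel a X).AppIdx (fun i => M.rel a (Y i)) (M.ord r).natPred
  | relEq a r X Y, M => (M.rel a X).at (M.ord r) = (M.rel a Y).at (M.ord r)
  | ordEq r p, M => M.ord r = M.ord p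
  | ordLt r p, M => M.ord r < M.ord p
  | neg φ, M => ¬ φ.Sat M
  | and φ ψ, M => φ.Sat M ∧ ψ.Sat M
  | or φ ψ, M => φ.Sat M ∨ ψ.Sat M
  | allOrd r φ, M => ∀ i : ℕ+, φ.Sat (M.setOrd r i)
  | exOrd r φ, M => ∃ i : ℕ+, φ.Sat (M.setOrd r i)
  | allRel a X φ, M => ∀ R : RelSeq A a, φ.Sat (M.setRel a X R)
  | exRel a X φ, M => ∃ R : RelSeq A a, φ.Sat (M.setRel a X R)

/-- The free order variables. -/
def freeOrd : VOFormula → Set ℕ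
  | app _ _ r _ => {r}
  | relEq _ r _ _ => {r}
  | ordEq r p => {r, p}
  | ordLt r p => {r, p}
  | neg φ => φ.freeOrd
  | and φ ψ => φ.freeOrd ∪ ψ.freeOrd
  | or φ ψ => φ.freeOrd ∪ ψ.freeOrd
  | allOrd r φ => φ.freeOrd \ {r}
  | exOrd r φ => φ.freeOrd \ {r}
  | allRel _ _ φ => φ.freeOrd
  | exRel _ _ φ => φ.freeOrd

/-- The free relation variables, each given by its arity and its name. -/
def freeRel : VOFormula → Set (ℕ+ × ℕ)
  | app a X _ Y => insert (a, X) (Set.range fun i => (a, Y i))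
  | relEq a _ X Y => {(a, X), (a, Y)}
  | ordEq _ _ => ∅
  | ordLt _ _ => ∅
  | neg φ => φ.freeRel
  | and φ ψ => φ.freeRel ∪ ψ.freeRel
  | or φ ψ => φ.freeRel ∪ ψ.freeRel
  | allOrd _ φ => φ.freeRel
  | exOrd _ φ => φ.freeRel
  | allRel a X φ => φ.freeRel \ {(a, X)}
  | exRel a X φ => φ.freeRel \ {(a, X)}

end VOFormula

/-! ## Coding of numbers and sets of numbers -/

/-- The pair of orders `(r, r')` codes the number `n`: `(1, 1)` codes `0`, and `(n, 2)` codes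
`n ≥ 1`. -/
def OrdCodes (r r' : ℕ+) (n : ℕ) : Prop :=
  (n = 0 ∧ r = 1 ∧ r' = 1) ∨ (1 ≤ n ∧ (r : ℕ) = n ∧ r' = 2)

/-- The monadic second-order relation `P²` (the element of order `2` of `P`) codes the number of
its elements. -/
def CardCodes {A : Type u} (P : RelSeq A 1) (n : ℕ) : Prop :=
  Set.ncard {y : A | Set.Mem (P 1) (fun _ => y)} = n

/-- The monadic sequence `X` codes `S`: for every `n`, the element of `X` of order `n + 2` is the
full relation if `n ∈ S` and the empty relation otherwise. -/
def SetCodes {A : Type u} (X : RelSeq A 1) (S : Set ℕ) : Prop :=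
  ∀ n : ℕ, (n ∈ S → X (n + 1) = (Set.univ : Set (Fin 1 → HRel A 1 n))) ∧
    (n ∉ S → X (n + 1) = (∅ : Set (Fin 1 → HRel A 1 n)))

/-!
In variable-order logic the orders are the positive integers with their linear order, and a sequence
of relations is a run of a machine with unboundedly growing memory: its element of order `r + 1`
can be compared with its element of order `r`, one order at a time. This is enough to interpret
second-order arithmetic, with order `n + 1` for the number `n`, even if only monadic sequences are
used and whatever the (finite, non-empty) universe is.

* A set of numbers is a monadic sequence `X`, with `n` in the set when the element of order `n + 2`
  is non-empty. Every set arises in this way (`RelSeq.exists_toSet_eq`), so that set quantifiers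
  become quantifiers over sequences.
* A number `p` is represented at all high orders at once by the sequence that is empty at order
  `p + 2` and then takes singletons (`RelSeq.IsCode`). At a fixed order the representations of
  different numbers are different (`RelSeq.IsCode.not_lt`): they are Zermelo's numerals. Hence a
  monadic sequence can store, at order `s + 3`, the set of all `q ≤ s` that are related to `s`, and
  every binary relation contained in `≤` is coded (`RelSeq.exists_codedRel_iff`).
* Quantification over these relations defines addition and multiplication by recursion, since their
  graphs `(q, p + q)` and, for `p > 0`, `(q, p * q)` are contained in `≤` (`eq_add_iff`,
  `eq_mul_iff`).
* The cardinality of a set of elements is defined by a sequence that starts with this set, replaces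
  all members by their singletons and drops one member, at each order, until nothing is left
  (`RelSeq.eq_ncard_elems_iff`).

Definability is handled semantically: `VODef` is a property of predicates on numbers and sequences,
closed under the logical operations, and `ArFormula.voDefHolds` shows by induction that the truth of
a formula of second-order arithmetic is definable from any definable values of its variables. The
two parts of the theorem differ only in the definable numbers that are put for the free variables.
-/

/-! ### Predicates definable in variable-order logic -/

/-- `VODef Q` says that the predicate `Q`, with order arguments (indexed by `ι`) and monadic
sequence arguments (indexed by `κ`), is definable in variable-order logic, by one formula for all
non-empty finite universes. Orders are numbered from `0`, so that the order `r`
is presented to `Q` as `r - 1`. Since a defining formula is required for every naming `f`, `g` of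
the arguments by variables, definable predicates may be substituted into each other without
any renaming of bound variables. -/
def VODef {ι κ : Type} (Q : ∀ A : Type u, (ι → ℕ) → (κ → RelSeq A 1) → Prop) : Prop :=
  ∀ (f : ι → ℕ) (g : κ → ℕ), ∃ ψ : VOFormula,
    ψ.freeOrd ⊆ Set.range f ∧ ψ.freeRel ⊆ Set.range (fun j => ((1 : ℕ+), g j)) ∧
    ∀ (A : Type u) [Finite A] [Nonempty A] (M : VOStructure A),
      ψ.Sat M ↔ Q A (fun i => (M.ord (f i)).natPred) (fun j => M.rel 1 (g j))

/-- `Y^(k+1) ∈ X^(k+2)` for monadic sequences `X` and `Y`: the element of `Y` at `k` belongs to the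
element of `X` at `k + 1`. -/
def RelSeq.MemAt {A : Type u} (X : RelSeq A 1) (k : ℕ) (Y : RelSeq A 1) : Prop :=
  Set.Mem (X (k + 1)) (fun _ => Y k)

namespace VODef

variable {ι κ : Type}

theorem congr {Q Q' : ∀ A : Type u, (ι → ℕ) → (κ → RelSeq A 1) → Prop} (h : VODef Q)
    (hQ : ∀ (A : Type u) [Finite A] [Nonempty A] (o : ι → ℕ) (v : κ → RelSeq A 1),
      Q' A o v ↔ Q A o v) : VODef Q' := by
  intro f g
  obtain ⟨ψ, h1, h2, h3⟩ := h f g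
  exact ⟨ψ, h1, h2, fun A _ _ M => (h3 A M).trans (hQ A _ _).symm⟩

/-- Change of context. -/
theorem reindex {ι' κ' : Type} {Q : ∀ A : Type u, (ι → ℕ) → (κ → RelSeq A 1) → Prop}
    (h : VODef Q) (a : ι → ι') (b : κ → κ') :
    VODef (fun A (o : ι' → ℕ) (v : κ' → RelSeq A 1) =>
      Q A (fun i => o (a i)) (fun j => v (b j))) := by
  intro f g
  obtain ⟨ψ, h1, h2, h3⟩ := h (fun i => f (a i)) (fun j => g (b j))
  refine ⟨ψ, h1.trans ?_, h2.trans ?_, h3⟩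
  · rintro _ ⟨i, rfl⟩
    exact ⟨a i, rfl⟩
  · rintro _ ⟨j, rfl⟩
    exact ⟨b j, rfl⟩

theorem eq (p q : ι) :
    VODef (fun (A : Type u) (o : ι → ℕ) (_ : κ → RelSeq A 1) => o p = o q) := by
  intro f g
  refine ⟨.ordEq (f p) (f q), ?_, Set.empty_subset _, fun A _ _ M => ?_⟩
  · rintro _ (rfl | rfl) <;> exact ⟨_, rfl⟩
  · exact PNat.natPred_inj.symm

theorem lt (p q : ι) :
    VODef (fun (A : Type u) (o : ι → ℕ) (_ : κ → RelSeq A 1) => o p < o q) := by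
  intro f g
  refine ⟨.ordLt (f p) (f q), ?_, Set.empty_subset _, fun A _ _ M => ?_⟩
  · rintro _ (rfl | rfl) <;> exact ⟨_, rfl⟩
  · exact PNat.natPred_lt_natPred.symm

theorem relEq (r : ι) (X Y : κ) :
    VODef (fun (A : Type u) (o : ι → ℕ) (v : κ → RelSeq A 1) => v X (o r) = v Y (o r)) := by
  intro f g
  refine ⟨.relEq 1 (f r) (g X) (g Y), ?_, ?_, fun A _ _ M => Iff.rfl⟩
  · rintro _ rfl
    exact ⟨_, rfl⟩
  · rintro _ (rfl | rfl) <;> exact ⟨_, rfl⟩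

theorem app (X Y : κ) (r : ι) :
    VODef (fun (A : Type u) (o : ι → ℕ) (v : κ → RelSeq A 1) =>
      (v X).AppIdx (fun _ => v Y) (o r)) := by
  intro f g
  refine ⟨.app 1 (g X) (f r) (fun _ => g Y), ?_, ?_, fun A _ _ M => Iff.rfl⟩
  · rintro _ rfl
    exact ⟨_, rfl⟩
  · rintro _ (rfl | ⟨_, rfl⟩) <;> exact ⟨_, rfl⟩

variable {Q Q' : ∀ A : Type u, (ι → ℕ) → (κ → RelSeq A 1) → Prop}

theorem not (h : VODef Q) : VODef (fun A o v => ¬ Q A o v) := by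
  intro f g
  obtain ⟨ψ, h1, h2, h3⟩ := h f g
  exact ⟨.neg ψ, h1, h2, fun A _ _ M => not_congr (h3 A M)⟩

theorem and (h : VODef Q) (h' : VODef Q') : VODef (fun A o v => Q A o v ∧ Q' A o v) := by
  intro f g
  obtain ⟨ψ, h1, h2, h3⟩ := h f g
  obtain ⟨ψ', h1', h2', h3'⟩ := h' f g
  exact ⟨.and ψ ψ', Set.union_subset h1 h1', Set.union_subset h2 h2',
    fun A _ _ M => and_congr (h3 A M) (h3' A M)⟩

theorem or (h : VODef Q) (h' : VODef Q') : VODef (fun A o v => Q A o v ∨ Q' A o v) :=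
  (h.not.and h'.not).not.congr fun A _ _ o v => by tauto

theorem imp (h : VODef Q) (h' : VODef Q') : VODef (fun A o v => Q A o v → Q' A o v) :=
  (h.and h'.not).not.congr fun A _ _ o v => by tauto

theorem iff (h : VODef Q) (h' : VODef Q') : VODef (fun A o v => Q A o v ↔ Q' A o v) :=
  ((h.imp h').and (h'.imp h)).congr fun A _ _ o v => by tauto

/-- Quantification over numbers, by means of a quantifier over orders. -/
theorem exOrd [Finite ι] {Q : ∀ A : Type u, ℕ → (ι → ℕ) → (κ → RelSeq A 1) → Prop}
    (h : VODef (fun A (o : Option ι → ℕ) v => Q A (o none) (fun i => o (some i)) v)) :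
    VODef (fun A o v => ∃ n, Q A n o v) := by
  intro f g
  obtain ⟨x, hx⟩ := (Set.finite_range f).exists_notMem
  have hne : ∀ i, f i ≠ x := fun i hi => hx ⟨i, hi⟩
  obtain ⟨ψ, h1, h2, h3⟩ := h (fun i => i.elim x f) g
  refine ⟨.exOrd x ψ, ?_, h2, fun A _ _ M => ?_⟩
  · rintro y ⟨hy, hyx⟩
    obtain ⟨_ | i, rfl⟩ := h1 hy
    · exact absurd rfl hyx
    · exact ⟨i, rfl⟩
  · have key : ∀ i : ℕ+, ψ.Sat (M.setOrd x i) ↔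
        Q A i.natPred (fun i => (M.ord (f i)).natPred) (fun j => M.rel 1 (g j)) := by
      intro i
      rw [h3]
      simp [VOStructure.setOrd, hne]
    refine (exists_congr key).trans ⟨fun ⟨i, hi⟩ => ⟨_, hi⟩, fun ⟨n, hn⟩ => ⟨n.succPNat, ?_⟩⟩
    rwa [Nat.natPred_succPNat]

theorem allOrd [Finite ι] {Q : ∀ A : Type u, ℕ → (ι → ℕ) → (κ → RelSeq A 1) → Prop}
    (h : VODef (fun A (o : Option ι → ℕ) v => Q A (o none) (fun i => o (some i)) v)) :
    VODef (fun A o v => ∀ n, Q A n o v) :=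
  (exOrd (Q := fun A n o v => ¬ Q A n o v) h.not).not.congr fun A _ _ o v => by simp

theorem exRel [Finite κ] {Q : ∀ A : Type u, (ι → ℕ) → RelSeq A 1 → (κ → RelSeq A 1) → Prop}
    (h : VODef (fun A o (v : Option κ → RelSeq A 1) =>
      Q A o (v none) (fun j => v (some j)))) :
    VODef (fun A o v => ∃ X, Q A o X v) := by
  intro f g
  obtain ⟨x, hx⟩ := (Set.finite_range g).exists_notMem
  have hne : ∀ i, g i ≠ x := fun i hi => hx ⟨i, hi⟩
  obtain ⟨ψ, h1, h2, h3⟩ := h f (fun i => i.elim x g)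
  refine ⟨.exRel 1 x ψ, h1, ?_, fun A _ _ M => ?_⟩
  · rintro y ⟨hy, hyx⟩
    obtain ⟨_ | i, rfl⟩ := h2 hy
    · exact absurd rfl hyx
    · exact ⟨i, rfl⟩
  · refine exists_congr fun X => ?_
    rw [h3]
    simp [VOStructure.setRel, hne]

theorem allRel [Finite κ] {Q : ∀ A : Type u, (ι → ℕ) → RelSeq A 1 → (κ → RelSeq A 1) → Prop}
    (h : VODef (fun A o (v : Option κ → RelSeq A 1) =>
      Q A o (v none) (fun j => v (some j)))) :
    VODef (fun A o v => ∀ X, Q A o X v) :=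
  (exRel (Q := fun A o X v => ¬ Q A o X v) h.not).not.congr fun A _ _ o v => by simp

theorem le (p q : ι) :
    VODef (fun (A : Type u) (o : ι → ℕ) (_ : κ → RelSeq A 1) => o p ≤ o q) :=
  (lt q p).not.congr fun A _ _ o v => by simp

theorem eq_zero [Finite ι] (p : ι) :
    VODef (fun (A : Type u) (o : ι → ℕ) (_ : κ → RelSeq A 1) => o p = 0) :=
  (exOrd (Q := fun _ t o _ => t < o p) (lt none (some p))).not.congr fun A _ _ o v =>
    ⟨fun h => by simp [h], fun h => by
      by_contra h0
      exact h ⟨0, Nat.pos_of_ne_zero h0⟩⟩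

theorem eq_succ [Finite ι] (p q : ι) :
    VODef (fun (A : Type u) (o : ι → ℕ) (_ : κ → RelSeq A 1) => o q = o p + 1) :=
  ((lt p q).and (exOrd (Q := fun _ t o _ => o p < t ∧ t < o q)
    ((lt (some p) none).and (lt none (some q)))).not).congr fun A _ _ o v =>
    ⟨fun h => ⟨by omega, fun ⟨t, ht⟩ => by omega⟩, fun ⟨h, h'⟩ => by
      by_contra h0
      exact h' ⟨o p + 1, by omega, by omega⟩⟩

/-- Evaluation of a definable predicate at a successor. -/
theorem subst_succ [Finite ι] {Q : ∀ A : Type u, ℕ → (ι → ℕ) → (κ → RelSeq A 1) → Prop}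
    (h : VODef (fun A (o : Option ι → ℕ) v => Q A (o none) (fun i => o (some i)) v)) (p : ι) :
    VODef (fun A o v => Q A (o p + 1) o v) :=
  (exOrd (Q := fun A n o v => n = o p + 1 ∧ Q A n o v) ((eq_succ (some p) none).and h)).congr
    fun A _ _ o v => by simp

theorem memAt [Finite ι] (X Y : κ) (k : ι) :
    VODef (fun (A : Type u) (o : ι → ℕ) (v : κ → RelSeq A 1) => (v X).MemAt (o k) (v Y)) :=
  subst_succ (Q := fun _ n _ v => (v X).AppIdx (fun _ => v Y) n) (app X Y none) k

end VODef

/-! ### Relations of higher order over a finite universe -/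

instance HRel.nonempty {A : Type u} [Nonempty A] {a : ℕ+} : ∀ k, Nonempty (HRel A a k)
  | 0 => ‹Nonempty A›
  | _ + 1 => ⟨(∅ : Set _)⟩

instance HRel.finite {A : Type u} [Finite A] {a : ℕ+} : ∀ k, Finite (HRel A a k)
  | 0 => ‹Finite A›
  | k + 1 =>
    have := HRel.finite (A := A) (a := a) k
    inferInstanceAs (Finite (Set (Fin (a : ℕ) → HRel A a k)))

namespace RelSeq

variable {A : Type u}

theorem exists_apply_eq [Nonempty A] {a : ℕ+} (k : ℕ) (y : HRel A a k) :
    ∃ Y : RelSeq A a, Y k = y :=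
  ⟨Function.update (fun _ => Classical.arbitrary _) k y, Function.update_self ..⟩

/-- Sequences with prescribed elements of order `2` and above. -/
theorem exists_memAt_iff [Nonempty A] (p : (k : ℕ) → HRel A 1 k → Prop) :
    ∃ X : RelSeq A 1, ∀ k Y, X.MemAt k Y ↔ p k (Y k) :=
  ⟨fun k => match k with
    | 0 => Classical.arbitrary _
    | k + 1 => ({t | p k (t 0)} : Set (Fin 1 → HRel A 1 k)), fun _ _ => Iff.rfl⟩

theorem apply_succ_ext [Nonempty A] {X Y : RelSeq A 1} {k : ℕ}
    (h : ∀ V, X.MemAt k V ↔ Y.MemAt k V) : X (k + 1) = Y (k + 1) := by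
  refine Set.ext (α := Fin 1 → HRel A 1 k) fun t => ?_
  obtain ⟨V, hV⟩ := exists_apply_eq k (t 0)
  have ht : t = fun _ => V k := by
    funext i
    rw [hV, Subsingleton.elim i 0]
  rw [ht]
  exact h V

theorem memAt_congr {X X' Y Y' : RelSeq A 1} {k : ℕ} (hX : X (k + 1) = X' (k + 1))
    (hY : Y k = Y' k) : X.MemAt k Y ↔ X'.MemAt k Y' := by
  simp only [MemAt, hX, hY]

/-- The set of numbers coded by a monadic sequence; a relation of order `n + 2` that is neither full
nor empty is treated as the full one. -/
def toSet (X : RelSeq A 1) : Set ℕ :=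
  {n | ∃ Y, X.MemAt n Y}

theorem exists_toSet_eq [Nonempty A] (S : Set ℕ) : ∃ X : RelSeq A 1, X.toSet = S := by
  obtain ⟨X, hX⟩ := exists_memAt_iff (A := A) (fun k _ => k ∈ S)
  refine ⟨X, Set.ext fun n => ⟨fun ⟨Y, hY⟩ => (hX n Y).1 hY, fun hn => ⟨X, (hX n X).2 hn⟩⟩⟩

/-! ### Coding binary relations on the natural numbers by monadic sequences -/

/-- `Z` represents the number `p` at all orders from `p + 2` on: it is the empty relation at order
`p + 2`, and its element of order `r + 1`, for `r ≥ p + 2`, is the singleton of that of order `r`. -/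
def IsCode (Z : RelSeq A 1) (p : ℕ) : Prop :=
  (∀ Y, ¬ Z.MemAt p Y) ∧ ∀ i, p ≤ i → ∀ Y : RelSeq A 1, Z.MemAt (i + 1) Y ↔ Y (i + 1) = Z (i + 1)

theorem exists_isCode [Nonempty A] (p : ℕ) : ∃ Z : RelSeq A 1, Z.IsCode p := by
  classical
  let Z : RelSeq A 1 := fun k => Nat.rec (motive := fun k => HRel A 1 k) (Classical.arbitrary _)
    (fun j z => ({t | p < j ∧ t 0 = z} : Set (Fin 1 → HRel A 1 j))) k
  have hZ : ∀ j Y, Z.MemAt j Y ↔ p < j ∧ Y j = Z j := fun j Y => Iff.rfl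
  refine ⟨Z, fun Y => ?_, fun i hi Y => ?_⟩
  · simp [hZ]
  · simp [hZ, Nat.lt_succ_of_le hi]

/-- The representations of different numbers differ at every order: as singletons are injective,
they could be equal only if some singleton was empty. -/
theorem IsCode.not_lt {Z Z' : RelSeq A 1} {p q i : ℕ} (hZ : Z.IsCode p) (hZ' : Z'.IsCode q)
    (hi : q ≤ i) (h : Z (i + 1) = Z' (i + 1)) : ¬ p < q := by
  intro hpq
  induction i, hi using Nat.le_induction with
  | base =>
    obtain ⟨q, rfl⟩ : ∃ q', q = q' + 1 := ⟨q - 1, by omega⟩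
    exact hZ'.1 Z ((memAt_congr h rfl).1 ((hZ.2 q (by omega) Z).2 rfl))
  | succ i hi ih =>
    exact ih ((hZ'.2 i hi Z).1 ((memAt_congr h rfl).1 ((hZ.2 i (by omega) Z).2 rfl)))

/-- The binary relation coded by `X`, between numbers `q ≤ s`: the element of `X` of order `s + 3`
contains the representation of `q` at order `s + 2`. -/
def CodedRel (X : RelSeq A 1) (q s : ℕ) : Prop :=
  q ≤ s ∧ ∃ Z : RelSeq A 1, Z.IsCode q ∧ X.MemAt (s + 1) Z

theorem exists_codedRel_iff [Nonempty A] (R : ℕ → ℕ → Prop) :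
    ∃ X : RelSeq A 1, ∀ q s, X.CodedRel q s ↔ q ≤ s ∧ R q s := by
  obtain ⟨X, hX⟩ := exists_memAt_iff (A := A) (fun k y =>
    ∃ q, q + 1 ≤ k ∧ R q (k - 1) ∧ ∃ Z : RelSeq A 1, Z.IsCode q ∧ y = Z k)
  refine ⟨X, fun q s => and_congr_right fun hqs => ⟨?_, fun h => ?_⟩⟩
  · rintro ⟨Z, hZ, hm⟩
    obtain ⟨q', hq', hR, Z', hZ', h⟩ := (hX _ _).1 hm
    obtain rfl : q = q' := le_antisymm
      (not_lt.1 (hZ'.not_lt hZ hqs h.symm)) (not_lt.1 (hZ.not_lt hZ' (by omega) h))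
    exact hR
  · obtain ⟨Z, hZ⟩ := exists_isCode (A := A) q
    exact ⟨Z, hZ, (hX _ _).2 ⟨q, by omega, h, Z, hZ, rfl⟩⟩

end RelSeq

namespace VODef

variable {ι κ : Type}

theorem isCode [Finite ι] [Finite κ] (Z : κ) (p : ι) :
    VODef (fun (A : Type u) (o : ι → ℕ) (v : κ → RelSeq A 1) => (v Z).IsCode (o p)) :=
  and (allRel (Q := fun _ o Y v => ¬ (v Z).MemAt (o p) Y) (memAt (some Z) none p).not)
    (allOrd (Q := fun A i o v => o p ≤ i → ∀ Y : RelSeq A 1,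
        (v Z).MemAt (i + 1) Y ↔ Y (i + 1) = (v Z) (i + 1))
      ((le (some p) none).imp
        (allRel (Q := fun _ o Y v => (v Z).MemAt (o none + 1) Y ↔
            Y (o none + 1) = (v Z) (o none + 1))
          (subst_succ (Q := fun _ n _ v => (v (some Z)).MemAt n (v none) ↔
              (v none) n = (v (some Z)) n)
            ((memAt (some Z) none none).iff (relEq none none (some Z))) none))))

theorem codedRel [Finite ι] [Finite κ] (X : κ) (q s : ι) :
    VODef (fun (A : Type u) (o : ι → ℕ) (v : κ → RelSeq A 1) => (v X).CodedRel (o q) (o s)) :=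
  and (le q s)
    (exRel (Q := fun _ o Z v => Z.IsCode (o q) ∧ (v X).MemAt (o s + 1) Z)
      ((isCode none q).and
        (subst_succ (Q := fun _ n _ v => (v (some X)).MemAt n (v none))
          (memAt (some X) none none) s)))

end VODef

/-! ### Addition and multiplication -/

/-- Addition of `p` is the least relation that contains `(0, p)` and is closed under adding `1` to
both numbers. -/
theorem eq_add_iff {A : Type u} [Nonempty A] (p q s : ℕ) :
    s = p + q ↔ ∀ X : RelSeq A 1, X.CodedRel 0 p →
      (∀ a b a' b', a' = a + 1 → b' = b + 1 → X.CodedRel a b → X.CodedRel a' b') →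
      X.CodedRel q s := by
  constructor
  · rintro rfl X h0 hs
    induction q with
    | zero => exact h0
    | succ q ih => exact hs _ _ _ _ rfl rfl ih
  · intro h
    obtain ⟨X, hX⟩ := RelSeq.exists_codedRel_iff (A := A) (fun q s => s = p + q)
    refine ((hX q s).1 (h X ?_ ?_)).2
    · simp [hX]
    · rintro a b _ _ rfl rfl
      simp only [hX]
      omega

/-- Multiplication by `p > 0` is the least relation that contains `(0, 0)` and is closed under
adding `1` to the first number and `p` to the second. For `p = 0` this relation has pairs whose
first number is larger than the second, which monadic sequences do not code. Zero and the successor occur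
through guarded quantifiers, as formulas of variable-order logic have no terms for them. -/
theorem eq_mul_iff {A : Type u} [Nonempty A] (p q s : ℕ) :
    s = p * q ↔ (p = 0 ∧ s = 0) ∨ (¬ p = 0 ∧ ∀ X : RelSeq A 1,
      (∀ a, a = 0 → X.CodedRel a a) →
      (∀ a b a' b', a' = a + 1 → b' = b + p → X.CodedRel a b → X.CodedRel a' b') →
      X.CodedRel q s) := by
  rcases Nat.eq_zero_or_pos p with rfl | hp
  · simp
  have hp' : p ≠ 0 := hp.ne'
  simp only [hp', false_and, not_false_eq_true, true_and, false_or]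
  constructor
  · rintro rfl X h0 hs
    induction q with
    | zero => exact h0 _ rfl
    | succ q ih => exact hs _ _ _ _ rfl rfl ih
  · intro h
    obtain ⟨X, hX⟩ := RelSeq.exists_codedRel_iff (A := A) (fun q s => s = p * q)
    refine ((hX q s).1 (h X ?_ ?_)).2
    · simp [hX]
    · rintro a b _ _ rfl rfl
      simp only [hX]
      rintro ⟨h1, rfl⟩
      exact ⟨by omega, by ring⟩

namespace VODef

variable {ι κ : Type}

theorem eq_add [Finite ι] [Finite κ] (p q s : ι) :
    VODef (fun (A : Type u) (o : ι → ℕ) (_ : κ → RelSeq A 1) => o s = o p + o q) := by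
  refine congr (Q := fun A o v => ∀ X : RelSeq A 1, (∀ z, z = 0 → X.CodedRel z (o p)) →
      (∀ a b a' b', a' = a + 1 → b' = b + 1 → X.CodedRel a b → X.CodedRel a' b') →
      X.CodedRel (o q) (o s)) ?_ fun A _ _ o v => by simpa using eq_add_iff (A := A) (o p) (o q) (o s)
  refine allRel (imp (allOrd ((eq_zero _).imp (codedRel _ _ _))) (imp ?_ (codedRel _ _ _)))
  exact allOrd (allOrd (allOrd (allOrd ((eq_succ _ _).imp ((eq_succ _ _).imp
    ((codedRel _ _ _).imp (codedRel _ _ _)))))))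

theorem eq_mul [Finite ι] [Finite κ] (p q s : ι) :
    VODef (fun (A : Type u) (o : ι → ℕ) (_ : κ → RelSeq A 1) => o s = o p * o q) := by
  refine congr ?_ fun A _ _ o v => eq_mul_iff (A := A) (o p) (o q) (o s)
  refine ((eq_zero _).and (eq_zero _)).or ((eq_zero _).not.and (allRel
    (imp (allOrd ((eq_zero _).imp (codedRel _ _ _))) (imp ?_ (codedRel _ _ _)))))
  exact allOrd (allOrd (allOrd (allOrd ((eq_succ _ _).imp ((eq_add _ _ _).imp
    ((codedRel _ _ _).imp (codedRel _ _ _)))))))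

end VODef

/-! ### Cardinalities of monadic relations -/

namespace RelSeq

variable {A : Type u}

/-- The element of order `k + 2` of a monadic sequence, as a set of relations of order `k + 1`. -/
def elems (X : RelSeq A 1) (k : ℕ) : Set (HRel A 1 k) :=
  {y | Set.Mem (X (k + 1)) (fun _ => y)}

/-- The monadic relation `{y}`. -/
def single {k : ℕ} (y : HRel A 1 k) : HRel A 1 (k + 1) :=
  ({t | t 0 = y} : Set (Fin 1 → HRel A 1 k))

theorem single_injective {k : ℕ} : Function.Injective (single (A := A) (k := k)) := by
  intro y z h
  have h' : Set.Mem (single y) (fun _ : Fin 1 => y) := Eq.refl y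
  rw [h] at h'
  exact h'

/-- Each element of `G`, as long as it is non-empty, is followed by the set of the singletons of all
its members but one. -/
def IsCountdown (G : RelSeq A 1) : Prop :=
  ∀ k, (∃ Y, G.MemAt k Y) → ∃ W, G.MemAt k W ∧ ∀ Y : RelSeq A 1, G.MemAt (k + 1) Y ↔
    ∃ V, G.MemAt k V ∧ ¬ V k = W k ∧ ∀ U, Y.MemAt k U ↔ U k = V k

theorem forall_memAt_iff_eq_single [Nonempty A] (Y V : RelSeq A 1) (k : ℕ) :
    (∀ U, Y.MemAt k U ↔ U k = V k) ↔ Y (k + 1) = single (V k) := by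
  obtain ⟨Z, hZ⟩ := exists_apply_eq (k + 1) (single (V k))
  have h : ∀ U, Z.MemAt k U ↔ U k = V k := by
    intro U
    rw [MemAt, hZ]
    exact Iff.rfl
  rw [← hZ]
  refine ⟨fun h' => apply_succ_ext fun U => (h' U).trans (h U).symm, fun h' U => ?_⟩
  rw [← h U]
  exact memAt_congr h' rfl

theorem exists_memAt_iff_elems_nonempty [Nonempty A] (G : RelSeq A 1) (k : ℕ) :
    (∃ Y, G.MemAt k Y) ↔ (G.elems k).Nonempty := by
  constructor
  · rintro ⟨Y, hY⟩
    exact ⟨Y k, hY⟩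
  · rintro ⟨y, hy⟩
    obtain ⟨Y, rfl⟩ := exists_apply_eq k y
    exact ⟨Y, hy⟩

theorem IsCountdown.ncard_elems [Finite A] [Nonempty A] {G : RelSeq A 1} (hG : G.IsCountdown)
    (k : ℕ) (hk : k ≤ (G.elems 0).ncard) : (G.elems k).ncard + k = (G.elems 0).ncard := by
  induction k with
  | zero => rfl
  | succ k ih =>
    have ih := ih (by omega)
    obtain ⟨W, hW, h⟩ := hG k ((exists_memAt_iff_elems_nonempty G k).2
      (Set.nonempty_of_ncard_ne_zero (by omega)))
    have hW' : W k ∈ G.elems k := hW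
    have key : G.elems (k + 1) = single '' (G.elems k \ {W k}) := by
      ext y
      obtain ⟨Y, rfl⟩ := exists_apply_eq (k + 1) y
      refine (h Y).trans ⟨?_, ?_⟩
      · rintro ⟨V, hV, hne, hs⟩
        exact ⟨V k, ⟨hV, hne⟩, ((forall_memAt_iff_eq_single Y V k).1 hs).symm⟩
      · rintro ⟨z, ⟨hz, hne⟩, hs⟩
        obtain ⟨V, rfl⟩ := exists_apply_eq k z
        exact ⟨V, hz, hne, (forall_memAt_iff_eq_single Y V k).2 hs.symm⟩
    rw [key, Set.ncard_image_of_injective _ single_injective,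
      Set.ncard_sdiff_singleton_of_mem hW']
    omega

theorem exists_isCountdown [Nonempty A] (P : RelSeq A 1) :
    ∃ G : RelSeq A 1, G.IsCountdown ∧ G 1 = P 1 := by
  classical
  -- The member that is left out of a non-empty relation, and an irrelevant value for the empty one.
  let w : (k : ℕ) → HRel A 1 (k + 1) → HRel A 1 k := fun k g =>
    if h : ∃ y : HRel A 1 k, Set.Mem g (fun _ => y) then h.choose else Classical.arbitrary _
  have hw : ∀ k g, (∃ y : HRel A 1 k, Set.Mem g (fun _ => y)) → Set.Mem g (fun _ => w k g) := by
    intro k g h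
    simp only [w, dif_pos h]
    exact h.choose_spec
  let H : (k : ℕ) → HRel A 1 (k + 1) := fun k =>
    Nat.rec (motive := fun k => HRel A 1 (k + 1)) (P 1)
      (fun k g => ({t | ∃ y : HRel A 1 k, Set.Mem g (fun _ => y) ∧ ¬ y = w k g ∧
        t 0 = single y} : Set (Fin 1 → HRel A 1 (k + 1)))) k
  let G : RelSeq A 1 := fun k => match k with
    | 0 => Classical.arbitrary _
    | k + 1 => H k
  refine ⟨G, ?_, rfl⟩
  rintro k ⟨Y, hY⟩
  obtain ⟨W, hW⟩ := exists_apply_eq k (w k (G (k + 1)))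
  refine ⟨W, ?_, fun Y => ?_⟩
  · rw [MemAt, hW]
    exact hw _ _ ⟨_, hY⟩
  · have h : G.MemAt (k + 1) Y ↔ ∃ y : HRel A 1 k, Set.Mem (G (k + 1)) (fun _ => y) ∧
        ¬ y = w k (G (k + 1)) ∧ Y (k + 1) = single y := Iff.rfl
    simp only [forall_memAt_iff_eq_single, hW, h]
    constructor
    · rintro ⟨y, hy⟩
      obtain ⟨V, rfl⟩ := exists_apply_eq k y
      exact ⟨V, hy⟩
    · rintro ⟨V, hV⟩
      exact ⟨V k, hV⟩

/-- The cardinality of `P²` is the time at which a countdown from `P²` reaches the empty set. -/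
theorem eq_ncard_elems_iff [Finite A] [Nonempty A] (P : RelSeq A 1) (n : ℕ) :
    n = (P.elems 0).ncard ↔ ∃ G : RelSeq A 1, G.IsCountdown ∧
      (∀ z, z = 0 → ∀ Y, G.MemAt z Y ↔ P.MemAt z Y) ∧ (∀ k, k < n → ∃ Y, G.MemAt k Y) ∧
      ¬ ∃ Y, G.MemAt n Y := by
  simp only [exists_memAt_iff_elems_nonempty, forall_eq]
  constructor
  · rintro rfl
    obtain ⟨G, hG, h1⟩ := exists_isCountdown P
    have h0 : G.elems 0 = P.elems 0 := by
      simp only [elems]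
      rw [h1]
    have hc := hG.ncard_elems
    rw [h0] at hc
    refine ⟨G, hG, fun Y => memAt_congr h1 rfl, fun k hk => ?_, ?_⟩
    · exact Set.nonempty_of_ncard_ne_zero (by have := hc k hk.le; omega)
    · rw [Set.not_nonempty_iff_eq_empty, ← Set.ncard_eq_zero]
      have := hc _ le_rfl
      omega
  · rintro ⟨G, hG, h0, hlt, hn⟩
    have h1 : G 1 = P 1 := apply_succ_ext h0
    have h0 : G.elems 0 = P.elems 0 := by
      simp only [elems]
      rw [h1]
    have hc := hG.ncard_elems
    rw [h0] at hc
    rw [Set.not_nonempty_iff_eq_empty, ← Set.ncard_eq_zero] at hn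
    rcases lt_trichotomy n (P.elems 0).ncard with h | h | h
    · have := hc n h.le
      omega
    · exact h
    · have h2 := (Set.ncard_pos (Set.toFinite _)).2 (hlt _ h)
      have := hc _ le_rfl
      omega

end RelSeq

namespace VODef

variable {ι κ : Type}

theorem isCountdown [Finite ι] [Finite κ] (G : κ) :
    VODef (fun (A : Type u) (_ : ι → ℕ) (v : κ → RelSeq A 1) => (v G).IsCountdown) := by
  refine allOrd (imp (exRel (memAt _ _ _)) (exRel (and (memAt _ _ _) (allRel (iff ?_ ?_)))))
  · exact subst_succ (Q := fun A n o v => (v (some (some G))).MemAt n (v none)) (memAt _ _ _) _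
  · exact exRel ((memAt _ _ _).and ((relEq _ _ _).not.and
      (allRel ((memAt _ _ _).iff (relEq _ _ _)))))

theorem eq_ncard_elems [Finite ι] [Finite κ] (P : κ) (p : ι) :
    VODef (fun (A : Type u) (o : ι → ℕ) (v : κ → RelSeq A 1) =>
      o p = ((v P).elems 0).ncard) := by
  refine congr ?_ fun A _ _ o v => RelSeq.eq_ncard_elems_iff (v P) (o p)
  exact exRel ((isCountdown _).and ((allOrd ((eq_zero _).imp (allRel
    ((memAt _ _ _).iff (memAt _ _ _))))).and ((allOrd ((lt _ _).imp (exRel (memAt _ _ _)))).and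
      (exRel (memAt _ _ _)).not)))

end VODef

/-! ### Interpretation of second-order arithmetic -/

/-- Definability of a number, by its graph. -/
def VODefNum {ι κ : Type} (N : ∀ A : Type u, (ι → ℕ) → (κ → RelSeq A 1) → ℕ) : Prop :=
  VODef (fun A (o : Option ι → ℕ) v => o none = N A (fun i => o (some i)) v)

/-- Definability of a set of numbers. -/
def VODefSet {ι κ : Type} (S : ∀ A : Type u, (ι → ℕ) → (κ → RelSeq A 1) → Set ℕ) : Prop :=
  VODef (fun A (o : Option ι → ℕ) v => o none ∈ S A (fun i => o (some i)) v)

section Interpretation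

variable {ι κ : Type}

theorem VODefNum.reindex {ι' κ' : Type} {N : ∀ A : Type u, (ι → ℕ) → (κ → RelSeq A 1) → ℕ}
    (h : VODefNum N) (a : ι → ι') (b : κ → κ') :
    VODefNum (fun A (o : ι' → ℕ) (v : κ' → RelSeq A 1) =>
      N A (fun i => o (a i)) (fun j => v (b j))) :=
  VODef.reindex h (Option.map a) b

theorem VODefSet.reindex {ι' κ' : Type} {S : ∀ A : Type u, (ι → ℕ) → (κ → RelSeq A 1) → Set ℕ}
    (h : VODefSet S) (a : ι → ι') (b : κ → κ') :
    VODefSet (fun A (o : ι' → ℕ) (v : κ' → RelSeq A 1) =>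
      S A (fun i => o (a i)) (fun j => v (b j))) :=
  VODef.reindex h (Option.map a) b

/-- Substitution of a definable number in a definable predicate. -/
theorem VODef.subst [Finite ι] {N : ∀ A : Type u, (ι → ℕ) → (κ → RelSeq A 1) → ℕ}
    {Q : ∀ A : Type u, ℕ → (ι → ℕ) → (κ → RelSeq A 1) → Prop}
    (h : VODef (fun A (o : Option ι → ℕ) v => Q A (o none) (fun i => o (some i)) v))
    (hN : VODefNum N) : VODef (fun A o v => Q A (N A o v) o v) :=
  (exOrd (Q := fun A n o v => n = N A o v ∧ Q A n o v) (VODef.and hN h)).congr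
    fun A _ _ o v => by simp

theorem VODefNum.var (p : ι) :
    VODefNum (fun (A : Type u) (o : ι → ℕ) (_ : κ → RelSeq A 1) => o p) :=
  VODef.eq none (some p)

theorem VODefNum.zero [Finite ι] :
    VODefNum (fun (A : Type u) (_ : ι → ℕ) (_ : κ → RelSeq A 1) => 0) :=
  VODef.eq_zero none

theorem VODefSet.empty : VODefSet (fun (A : Type u) (_ : ι → ℕ) (_ : κ → RelSeq A 1) => ∅) :=
  ((VODef.lt none none).congr fun _ _ _ _ _ => by simp)

theorem VODefNum.ncard_elems [Finite ι] [Finite κ] (P : κ) :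
    VODefNum (fun (A : Type u) (_ : ι → ℕ) (v : κ → RelSeq A 1) => ((v P).elems 0).ncard) :=
  VODef.eq_ncard_elems P none

theorem VODefSet.toSet [Finite ι] [Finite κ] (X : κ) :
    VODefSet (fun (A : Type u) (_ : ι → ℕ) (v : κ → RelSeq A 1) => (v X).toSet) :=
  VODef.exRel (VODef.memAt (some X) none none)

namespace ArTerm

theorem voDefNum_val [Finite ι] [Finite κ]
    {N : ℕ → ∀ A : Type u, (ι → ℕ) → (κ → RelSeq A 1) → ℕ} (hN : ∀ x, VODefNum (N x))
    (t : ArTerm) : VODefNum (fun A o v => t.val (fun x => N x A o v)) := by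
  induction t with
  | var x => exact hN x
  | add t u iht ihu =>
    refine VODef.subst (Q := fun A n o v =>
      o none = n + u.val (fun x => N x A (fun i => o (some i)) v)) ?_
      (iht.reindex some id)
    exact VODef.subst (Q := fun _ n o _ => o (some none) = o none + n) (VODef.eq_add _ _ _)
      (ihu.reindex (fun i => some (some i)) id)
  | mul t u iht ihu =>
    refine VODef.subst (Q := fun A n o v =>
      o none = n * u.val (fun x => N x A (fun i => o (some i)) v)) ?_
      (iht.reindex some id)
    exact VODef.subst (Q := fun _ n o _ => o (some none) = o none * n) (VODef.eq_mul _ _ _)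
      (ihu.reindex (fun i => some (some i)) id)

theorem val_congr {e e' : ℕ → ℕ} {t : ArTerm} (h : ∀ x ∈ t.vars, e x = e' x) :
    t.val e = t.val e' := by
  induction t with
  | var x => exact h x rfl
  | add t u iht ihu =>
    simp only [val, iht fun x hx => h x (Or.inl hx), ihu fun x hx => h x (Or.inr hx)]
  | mul t u iht ihu =>
    simp only [val, iht fun x hx => h x (Or.inl hx), ihu fun x hx => h x (Or.inr hx)]

theorem finite_vars (t : ArTerm) : t.vars.Finite := by
  induction t with
  | var x => exact Set.finite_singleton x
  | add t u iht ihu => exact iht.union ihu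
  | mul t u iht ihu => exact iht.union ihu

end ArTerm

namespace ArFormula

/-- Variable-order logic defines the truth of `φ` whenever it defines the values of the number
and set variables. -/
def VODefHolds (φ : ArFormula) : Prop :=
  ∀ {ι κ : Type} [Finite ι] [Finite κ]
    {N : ℕ → ∀ A : Type u, (ι → ℕ) → (κ → RelSeq A 1) → ℕ}
    {S : ℕ → ∀ A : Type u, (ι → ℕ) → (κ → RelSeq A 1) → Set ℕ},
    (∀ x, VODefNum (N x)) → (∀ X, VODefSet (S X)) →
      VODef (fun A o v => φ.Holds (fun x => N x A o v) (fun X => S X A o v))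

variable [Finite ι] [Finite κ]
  {N : ℕ → ∀ A : Type u, (ι → ℕ) → (κ → RelSeq A 1) → ℕ}
  {S : ℕ → ∀ A : Type u, (ι → ℕ) → (κ → RelSeq A 1) → Set ℕ}

theorem VODefHolds.updateNum {φ : ArFormula} (h : VODefHolds.{u} φ)
    (hN : ∀ x, VODefNum (N x)) (hS : ∀ X, VODefSet (S X)) (x : ℕ) :
    VODef (fun A (o : Option ι → ℕ) (v : κ → RelSeq A 1) =>
      φ.Holds (Function.update (fun x => N x A (fun i => o (some i)) v) x (o none))
        (fun X => S X A (fun i => o (some i)) v)) := by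
  refine h (N := fun y A o v =>
    Function.update (fun y => N y A (fun i => o (some i)) v) x (o none) y)
    (S := fun X A o v => S X A (fun i => o (some i)) v) (fun y => ?_)
    (fun X => (hS X).reindex some id)
  by_cases hy : y = x
  · subst hy
    simpa using VODefNum.var none
  · simpa [hy] using (hN y).reindex some id

theorem VODefHolds.updateSet {φ : ArFormula} (h : VODefHolds.{u} φ)
    (hN : ∀ x, VODefNum (N x)) (hS : ∀ X, VODefSet (S X)) (X : ℕ) :
    VODef (fun A (o : ι → ℕ) (v : Option κ → RelSeq A 1) =>
      φ.Holds (fun x => N x A o (fun j => v (some j)))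
        (Function.update (fun X => S X A o (fun j => v (some j))) X (v none).toSet)) := by
  refine h (N := fun x A o v => N x A o (fun j => v (some j)))
    (S := fun Y A o v =>
      Function.update (fun Y => S Y A o (fun j => v (some j))) X (v none).toSet Y)
    (fun x => (hN x).reindex id some) (fun Y => ?_)
  by_cases hY : Y = X
  · subst hY
    simpa using VODefSet.toSet none
  · simpa [hY] using (hS Y).reindex id some

/-- Variable-order logic interprets second-order arithmetic. -/
theorem voDefHolds (φ : ArFormula) : VODefHolds.{u} φ := by
  induction φ with
  | eq t u =>
    intro ι κ _ _ N S hN _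
    exact VODef.subst (Q := fun A n o v => n = u.val (fun x => N x A o v))
      (ArTerm.voDefNum_val hN u) (ArTerm.voDefNum_val hN t)
  | mem t X =>
    intro ι κ _ _ N S hN hS
    exact VODef.subst (Q := fun A n o v => n ∈ S X A o v) (hS X) (ArTerm.voDefNum_val hN t)
  | neg φ ih =>
    intro ι κ _ _ N S hN hS
    exact (ih hN hS).not
  | and φ ψ ihφ ihψ =>
    intro ι κ _ _ N S hN hS
    exact (ihφ hN hS).and (ihψ hN hS)
  | or φ ψ ihφ ihψ =>
    intro ι κ _ _ N S hN hS
    exact (ihφ hN hS).or (ihψ hN hS)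
  | allNum x φ ih =>
    intro ι κ _ _ N S hN hS
    exact VODef.allOrd (Q := fun A n o v => φ.Holds (Function.update (fun x => N x A o v) x n)
      (fun X => S X A o v)) (ih.updateNum hN hS x)
  | exNum x φ ih =>
    intro ι κ _ _ N S hN hS
    exact VODef.exOrd (Q := fun A n o v => φ.Holds (Function.update (fun x => N x A o v) x n)
      (fun X => S X A o v)) (ih.updateNum hN hS x)
  | allSet X φ ih =>
    intro ι κ _ _ N S hN hS
    refine VODef.congr (VODef.allRel (Q := fun A o R v => φ.Holds (fun x => N x A o v)
      (Function.update (fun X => S X A o v) X R.toSet)) (ih.updateSet hN hS X)) ?_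
    intro A _ _ o v
    exact (Function.Surjective.forall RelSeq.exists_toSet_eq)
  | exSet X φ ih =>
    intro ι κ _ _ N S hN hS
    refine VODef.congr (VODef.exRel (Q := fun A o R v => φ.Holds (fun x => N x A o v)
      (Function.update (fun X => S X A o v) X R.toSet)) (ih.updateSet hN hS X)) ?_
    intro A _ _ o v
    exact (Function.Surjective.exists RelSeq.exists_toSet_eq)

theorem holds_congr {φ : ArFormula} {e e' : ℕ → ℕ} {s s' : ℕ → Set ℕ}
    (he : ∀ x ∈ φ.freeNum, e x = e' x) (hs : ∀ X ∈ φ.freeSet, s X = s' X) :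
    φ.Holds e s ↔ φ.Holds e' s' := by
  have updNum : ∀ {F : Set ℕ} {e e' : ℕ → ℕ} {x : ℕ} (n : ℕ), (∀ y ∈ F \ {x}, e y = e' y) →
      ∀ y ∈ F, Function.update e x n y = Function.update e' x n y := by
    intro F e e' x n h y hy
    by_cases hyx : y = x
    · simp [hyx]
    · simpa [hyx] using h y ⟨hy, hyx⟩
  have updSet : ∀ {F : Set ℕ} {s s' : ℕ → Set ℕ} {X : ℕ} (S : Set ℕ),
      (∀ Y ∈ F \ {X}, s Y = s' Y) →
      ∀ Y ∈ F, Function.update s X S Y = Function.update s' X S Y := by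
    intro F s s' X S h Y hY
    by_cases hYX : Y = X
    · simp [hYX]
    · simpa [hYX] using h Y ⟨hY, hYX⟩
  induction φ generalizing e e' s s' with
  | eq t u =>
    simp only [Holds, ArTerm.val_congr fun x hx => he x (Or.inl hx),
      ArTerm.val_congr fun x hx => he x (Or.inr hx)]
  | mem t X => simp only [Holds, ArTerm.val_congr he, hs X rfl]
  | neg φ ih => exact not_congr (ih he hs)
  | and φ ψ ihφ ihψ =>
    exact and_congr (ihφ (fun x hx => he x (Or.inl hx)) fun X hX => hs X (Or.inl hX))
      (ihψ (fun x hx => he x (Or.inr hx)) fun X hX => hs X (Or.inr hX))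
  | or φ ψ ihφ ihψ =>
    exact or_congr (ihφ (fun x hx => he x (Or.inl hx)) fun X hX => hs X (Or.inl hX))
      (ihψ (fun x hx => he x (Or.inr hx)) fun X hX => hs X (Or.inr hX))
  | allNum x φ ih => exact forall_congr' fun n => ih (updNum n he) hs
  | exNum x φ ih => exact exists_congr fun n => ih (updNum n he) hs
  | allSet X φ ih => exact forall_congr' fun S => ih he (updSet S hs)
  | exSet X φ ih => exact exists_congr fun S => ih he (updSet S hs)

theorem finite_freeNum (φ : ArFormula) : φ.freeNum.Finite := by
  induction φ with
  | eq t u => exact t.finite_vars.union u.finite_vars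
  | mem t X => exact t.finite_vars
  | neg φ ih => exact ih
  | and φ ψ ihφ ihψ => exact ihφ.union ihψ
  | or φ ψ ihφ ihψ => exact ihφ.union ihψ
  | allNum x φ ih => exact ih.sdiff
  | exNum x φ ih => exact ih.sdiff
  | allSet X φ ih => exact ih
  | exSet X φ ih => exact ih

theorem finite_freeSet (φ : ArFormula) : φ.freeSet.Finite := by
  induction φ with
  | eq t u => exact Set.finite_empty
  | mem t X => exact Set.finite_singleton X
  | neg φ ih => exact ih
  | and φ ψ ihφ ihψ => exact ihφ.union ihψ
  | or φ ψ ihφ ihψ => exact ihφ.union ihψ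
  | allNum x φ ih => exact ih
  | exNum x φ ih => exact ih
  | allSet X φ ih => exact ih.sdiff
  | exSet X φ ih => exact ih.sdiff

end ArFormula

end Interpretation

/-! ### Decoding the free variables -/

/-- The number coded by a pair of orders `(r, r')`, given as `o p = r - 1` and `o q = r' - 1`. -/
theorem VODefNum.ordDecode {ι κ : Type} [Finite ι] (p q : ι) :
    VODefNum (fun (A : Type u) (o : ι → ℕ) (_ : κ → RelSeq A 1) =>
      if o q = 0 then o p else o p + 1) := by
  refine VODef.congr (((VODef.eq_zero (some q)).and (VODef.eq none (some p))).or
    ((VODef.eq_zero (some q)).not.and (VODef.eq_succ (some p) none))) fun A _ _ o v => ?_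
  by_cases h : o (some q) = 0 <;> simp [h]

theorem OrdCodes.decode {r r' : ℕ+} {n : ℕ} (h : OrdCodes r r' n) :
    (if r'.natPred = 0 then r.natPred else r.natPred + 1) = n := by
  rcases h with ⟨rfl, rfl, rfl⟩ | ⟨-, rfl, rfl⟩
  · rfl
  · exact (if_neg one_ne_zero).trans r.natPred_add_one

theorem SetCodes.toSet_eq {A : Type u} [Nonempty A] {X : RelSeq A 1} {S : Set ℕ}
    (h : SetCodes X S) : X.toSet = S := by
  ext n
  refine ⟨fun ⟨Y, hY⟩ => ?_, fun hn => ⟨X, ?_⟩⟩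
  · by_contra hn
    rw [RelSeq.MemAt, (h n).2 hn] at hY
    exact hY
  · rw [RelSeq.MemAt, (h n).1 hn]
    exact trivial

theorem mainTheorem7 (φ : ArFormula) (hφ : φ.Analytical) :
    -- numbers are given by pairs of order symbols, sets by sequences of relations
    (∃ ψ : VOFormula,
      ψ.freeOrd ⊆ {r : ℕ | ∃ x ∈ φ.freeNum, r = 2 * x ∨ r = 2 * x + 1} ∧
      ψ.freeRel ⊆ {p : ℕ+ × ℕ | ∃ X ∈ φ.freeSet, p = (1, X)} ∧
      ∀ (A : Type u) [Finite A] [Nonempty A] (M : VOStructure A) (e : ℕ → ℕ) (s : ℕ → Set ℕ),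
        (∀ x ∈ φ.freeNum, OrdCodes (M.ord (2 * x)) (M.ord (2 * x + 1)) (e x)) →
        (∀ X ∈ φ.freeSet, SetCodes (M.rel 1 X) (s X)) →
        (ψ.Sat M ↔ φ.Holds e s)) ∧
    -- numbers are given by cardinalities of monadic relations; no order symbol is free
    (∃ ψ : VOFormula,
      ψ.freeOrd = ∅ ∧
      ψ.freeRel ⊆ {p : ℕ+ × ℕ | (∃ x ∈ φ.freeNum, p = (1, 2 * x)) ∨
        ∃ X ∈ φ.freeSet, p = (1, 2 * X + 1)} ∧
      ∀ (A : Type u) [Finite A] [Nonempty A] (M : VOStructure A) (e : ℕ → ℕ) (s : ℕ → Set ℕ),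
        (∀ x ∈ φ.freeNum, CardCodes (M.rel 1 (2 * x)) (e x)) →
        (∀ X ∈ φ.freeSet, SetCodes (M.rel 1 (2 * X + 1)) (s X)) →
        (ψ.Sat M ↔ φ.Holds e s)) := by
  classical
  have := φ.finite_freeNum.to_subtype
  have := φ.finite_freeSet.to_subtype
  constructor
  · -- The two order arguments for a number variable are told apart by a Boolean.
    obtain ⟨ψ, h1, h2, h3⟩ := φ.voDefHolds (ι := φ.freeNum × Bool) (κ := φ.freeSet)
      (N := fun x A o v => if hx : x ∈ φ.freeNum then
        if o (⟨x, hx⟩, true) = 0 then o (⟨x, hx⟩, false) else o (⟨x, hx⟩, false) + 1 else 0)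
      (S := fun X A o v => if hX : X ∈ φ.freeSet then (v ⟨X, hX⟩).toSet else ∅)
      (fun x => by
        by_cases hx : x ∈ φ.freeNum
        · simpa only [hx, dif_pos] using VODefNum.ordDecode _ _
        · simpa only [hx, dif_neg, not_false_eq_true] using VODefNum.zero)
      (fun X => by
        by_cases hX : X ∈ φ.freeSet
        · simpa only [hX, dif_pos] using VODefSet.toSet _
        · simpa only [hX, dif_neg, not_false_eq_true] using VODefSet.empty)
      (fun i => if i.2 then 2 * i.1 + 1 else 2 * i.1) (fun j => j)
    refine ⟨ψ, h1.trans ?_, h2.trans ?_, fun A _ _ M e s he hs => ?_⟩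
    · rintro _ ⟨⟨⟨x, hx⟩, _ | _⟩, rfl⟩
      · exact ⟨x, hx, Or.inl rfl⟩
      · exact ⟨x, hx, Or.inr rfl⟩
    · rintro _ ⟨⟨X, hX⟩, rfl⟩
      exact ⟨X, hX, rfl⟩
    · refine (h3 A M).trans (ArFormula.holds_congr (fun x hx => ?_) fun X hX => ?_)
      · simpa [hx] using (he x hx).decode
      · simpa [hX] using (hs X hX).toSet_eq
  · obtain ⟨ψ, h1, h2, h3⟩ := φ.voDefHolds (ι := Empty) (κ := φ.freeNum ⊕ φ.freeSet)
      (N := fun x A o v => if hx : x ∈ φ.freeNum then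
        ((v (Sum.inl ⟨x, hx⟩)).elems 0).ncard else 0)
      (S := fun X A o v => if hX : X ∈ φ.freeSet then (v (Sum.inr ⟨X, hX⟩)).toSet else ∅)
      (fun x => by
        by_cases hx : x ∈ φ.freeNum
        · simpa only [hx, dif_pos] using VODefNum.ncard_elems _
        · simpa only [hx, dif_neg, not_false_eq_true] using VODefNum.zero)
      (fun X => by
        by_cases hX : X ∈ φ.freeSet
        · simpa only [hX, dif_pos] using VODefSet.toSet _
        · simpa only [hX, dif_neg, not_false_eq_true] using VODefSet.empty)
      Empty.elim (Sum.elim (fun x => 2 * x) (fun X => 2 * X + 1))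
    refine ⟨ψ, ?_, h2.trans ?_, fun A _ _ M e s he hs => ?_⟩
    · rwa [Set.range_eq_empty, Set.subset_empty_iff] at h1
    · rintro _ ⟨⟨x, hx⟩ | ⟨X, hX⟩, rfl⟩
      · exact Or.inl ⟨x, hx, rfl⟩
      · exact Or.inr ⟨X, hX, rfl⟩
    · refine (h3 A M).trans (ArFormula.holds_congr (fun x hx => ?_) fun X hX => ?_)
      · simp only [hx, dif_pos]
        exact he x hx
      · simpa [hX] using (hs X hX).toSet_eq
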